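/- Let $K$ be a commutative $\mathbb Q$-algebra, $n\ge 0$, and $D_i=\partial/\partial X_i$ on $K[[X_1,\dots,X_n]]$. A formal map of special type is a system $F=(F_1,\dots,F_n)$ with $F_i\in K[[X_1,\dots,X_n]]$ of the form $F_i=X_i+(\text{terms of degree}\ge 2)$; a formal inverse of $F$ is a formal map $G$ of special type with $F\circ G=G\circ F=(X_1,\dots,X_n)$. Let $P\in K[[X_1,\dots,X_n]]$ be such that $F=X-\nabla P$, i.e. $F_i=X_i-D_iP$, is a formal map of special type. For a finite tree $T$ with vertex set $V(T)$ and edge set $E(T)$ put $$\mathcal Q_{T,P}=\sum_{\ell:E(T)\to\{1,\dots,n\}}\ \prod_{v\in V(T)}D_{\mathrm{adj}(v)}P,\qquad D_{\mathrm{adj}(v)}=D_{\ell(e_1)}\cdots D_{\ell(e_s)},$$ where $e_1,\dots,e_s$ are the edges of $T$ adjacent to $v$. Let $\mathbb T$ be the set of isomorphism classes of finite free (unrooted) trees with at least one vertex. Then the sum $$Q=\sum_{T\in\mathbb T}\frac1{|\mathrm{Aut}\,T|}\,\mathcal Q_{T,P}$$ converges formally (for each monomial, only finitely many terms of the sum have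 a nonzero coefficient at it), and $F$ has exactly one formal inverse, namely $G=X+\nabla Q$, i.e. $G_i=X_i+D_iQ$ for $i=1,\dots,n$. -/

import Mathlib

namespace SymTree

open MvPowerSeries

section FormalMaps

/-- A system of `n` power series in `n` variables of the form `F i = X i + (higher degree terms)`. -/
def IsSpecialType {n : ℕ} {K : Type*} [CommRing K]
    (F : Fin n → MvPowerSeries (Fin n) K) : Prop :=
  ∀ i, ∀ d : Fin n →₀ ℕ, d.degree ≤ 1 → coeff d (F i - X i) = 0

/-- The composite `F ∘ G`, with components `F i (G 0, …, G (n - 1))`. -/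
noncomputable def comp {n : ℕ} {K : Type*} [CommRing K]
    (F G : Fin n → MvPowerSeries (Fin n) K) : Fin n → MvPowerSeries (Fin n) K :=
  fun i => subst G (F i)

/-- `G` is a formal inverse of `F`: a formal map of special type with `F ∘ G = G ∘ F = X`. -/
def IsFormalInverse {n : ℕ} {K : Type*} [CommRing K]
    (F G : Fin n → MvPowerSeries (Fin n) K) : Prop :=
  IsSpecialType G ∧ (∀ i, comp F G i = X i) ∧ (∀ i, comp G F i = X i)

/-- The family `f` of power series is formally summable with sum `s`: every coefficient is
nonzero for only finitely many members of the family, and the coefficients add up to those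
of `s`. -/
def IsFormalSum {n : ℕ} {K : Type*} [CommRing K] {ι : Type*}
    (f : ι → MvPowerSeries (Fin n) K) (s : MvPowerSeries (Fin n) K) : Prop :=
  ∀ d : Fin n →₀ ℕ, {i | coeff d (f i) ≠ 0}.Finite ∧ coeff d s = ∑ᶠ i, coeff d (f i)

theorem pderiv_comm {n : ℕ} {K : Type*} [CommRing K] (i j : Fin n)
    (f : MvPowerSeries (Fin n) K) :
    pderiv K i (pderiv K j f) = pderiv K j (pderiv K i f) := by
  ext d
  rw [coeff_pderiv, coeff_pderiv, coeff_pderiv, coeff_pderiv, add_right_comm]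
  by_cases h : i = j
  · subst h; rfl
  · simp [Finsupp.single_eq_of_ne h, Finsupp.single_eq_of_ne (Ne.symm h)]
    ring

instance pderivLeftCommutative {n : ℕ} {K : Type*} [CommRing K] :
    LeftCommutative (fun (i : Fin n) (f : MvPowerSeries (Fin n) K) => pderiv K i f) :=
  ⟨fun i j f => pderiv_comm i j f⟩

/-- The iterated derivative `D_{i₁} ⋯ D_{iₛ} P` for the multiset `{i₁, …, iₛ}` of indices. -/
noncomputable def iterPderiv {n : ℕ} {K : Type*} [CommRing K] (s : Multiset (Fin n))
    (P : MvPowerSeries (Fin n) K) : MvPowerSeries (Fin n) K :=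
  s.foldr (fun i f => pderiv K i f) P

end FormalMaps

section Trees

open Classical in
/-- The multiset of the labels of the edges adjacent to the vertex `v`. -/
noncomputable def adjLabels {V : Type*} [Fintype V] {n : ℕ} (T : SimpleGraph V)
    (l : T.edgeSet → Fin n) (v : V) : Multiset (Fin n) :=
  (Finset.univ.filter (fun e : T.edgeSet => v ∈ (e : Sym2 V))).val.map l

open Classical in
/-- `∑_{l : E(T) → {1, …, n}} ∏_{v ∈ V(T)} D_{adj(v)} P`. -/
noncomputable def graphTerm {V : Type*} [Fintype V] {n : ℕ} {K : Type*} [CommRing K]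
    (T : SimpleGraph V) (P : MvPowerSeries (Fin n) K) : MvPowerSeries (Fin n) K :=
  ∑ l : T.edgeSet → Fin n, ∏ v : V, iterPderiv (adjLabels T l v) P

theorem adjLabels_iso {V W : Type*} [Fintype V] [Fintype W] {n : ℕ} {S : SimpleGraph V}
    {T : SimpleGraph W} (φ : S ≃g T) (l : T.edgeSet → Fin n) (v : V) :
    adjLabels S (l ∘ φ.mapEdgeSet) v = adjLabels T l (φ v) := by
  classical
  unfold adjLabels
  rw [← Multiset.map_map]
  congr 1
  have h : (Finset.univ.filter (fun e : T.edgeSet => φ v ∈ (e : Sym2 W))) =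
      (Finset.univ.filter (fun e : S.edgeSet => v ∈ (e : Sym2 V))).map
        φ.mapEdgeSet.toEmbedding := by
    ext e
    obtain ⟨e, rfl⟩ := φ.mapEdgeSet.surjective e
    have : φ v ∈ ((φ.mapEdgeSet e : T.edgeSet) : Sym2 W) ↔ v ∈ (e : Sym2 V) := by
      change φ v ∈ Sym2.map φ (e : Sym2 V) ↔ _
      rw [Sym2.mem_map]
      constructor
      · rintro ⟨a, ha, h⟩
        rwa [← φ.injective h]
      · exact fun h => ⟨v, h, rfl⟩
    simp only [Finset.mem_filter, Finset.mem_univ, true_and, Finset.mem_map_equiv,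
      Equiv.symm_apply_apply, this]
  have h2 := congrArg Finset.val h
  rw [Finset.map_val] at h2
  exact h2.symm

theorem graphTerm_iso {V W : Type*} [Fintype V] [Fintype W] {n : ℕ} {K : Type*} [CommRing K]
    {S : SimpleGraph V} {T : SimpleGraph W} (φ : S ≃g T) (P : MvPowerSeries (Fin n) K) :
    graphTerm S P = graphTerm T P := by
  classical
  unfold graphTerm
  symm
  refine Fintype.sum_equiv (Equiv.arrowCongr φ.mapEdgeSet.symm (Equiv.refl (Fin n))) _ _ ?_
  intro l
  symm
  refine Fintype.prod_equiv φ.toEquiv _ _ ?_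
  intro v
  exact congrArg (fun s => iterPderiv s P) (adjLabels_iso φ l v)

theorem card_aut_iso {V W : Type*} {S : SimpleGraph V} {T : SimpleGraph W} (φ : S ≃g T) :
    Nat.card (S ≃g S) = Nat.card (T ≃g T) :=
  Nat.card_congr
    { toFun := fun a => (φ.symm.trans a).trans φ
      invFun := fun b => (φ.trans b).trans φ.symm
      left_inv := fun a => by ext; simp
      right_inv := fun b => by ext; simp }

/-- A finite tree, on one of the vertex sets `{0, …, m - 1}`. -/
def FinTree : Type := Σ m : ℕ, {T : SimpleGraph (Fin m) // T.IsTree}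

instance finTreeSetoid : Setoid FinTree where
  r S T := Nonempty (S.2.1 ≃g T.2.1)
  iseqv :=
    { refl := fun _ => ⟨SimpleGraph.Iso.refl⟩
      symm := fun ⟨φ⟩ => ⟨φ.symm⟩
      trans := fun ⟨φ⟩ ⟨ψ⟩ => ⟨φ.trans ψ⟩ }

/-- The set of isomorphism classes of finite free (unrooted) trees. -/
def FreeTree : Type := Quotient finTreeSetoid

/-- The order `|Aut T|` of the automorphism group of a free tree. -/
noncomputable def FreeTree.cardAut (T : FreeTree) : ℕ :=
  Quotient.lift (fun S : FinTree => Nat.card (S.2.1 ≃g S.2.1))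
    (by rintro S S' ⟨φ⟩; exact card_aut_iso φ) T

/-- The power series `Q_{T,P}` of a free tree. -/
noncomputable def FreeTree.term {n : ℕ} {K : Type*} [CommRing K] (T : FreeTree)
    (P : MvPowerSeries (Fin n) K) : MvPowerSeries (Fin n) K :=
  Quotient.lift (fun S : FinTree => graphTerm S.2.1 P)
    (by rintro S S' ⟨φ⟩; exact graphTerm_iso φ P) T

end Trees

end SymTree

/-! Mark edges by a parameter t: put U = ∑ t^j q_j, where q_j is the sum of the terms of trees with
j edges, weighted by 1/|Aut|. By orbit-stabilizer a tree with m vertices has m!/|Aut| labellings, so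
q_j is also a sum over labelled trees divided by (j+1)! (`sum_freeTreesOfSize`).

Cutting a labelled tree at an oriented edge gives two trees on complementary vertex sets, each with
a marked vertex, and this is reversible (`SplitTree.glue_bijective`). By the Leibniz rule, marking a
vertex with a half-edge labelled i is differentiation by D_i. Hence 2(j+1) q_{j+1} = ∑_{a+b=j} ∇q_a
· ∇q_b, that is, 2 ∂U/∂t = ∇U · ∇U with U = P at t = 0.

The gradient V = ∇U then solves the Burgers equation ∂V/∂t = (V·∇)V with initial value ∇P. Its
solution is implicit: V = ∇P(X + tV) (`eq_subst_of_burgers`). At t = 1 this reads ∇Q = ∇P(X + ∇Q),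
which is F ∘ (X + ∇Q) = X. Left cancellation of F (`eq_of_subst_eq`) gives uniqueness and the other
composite.

Convergence is a degree count: a vertex of degree s ≥ 1 contributes order at least 3 - s, so a tree
with m ≥ 2 vertices has a term of order at least 3m - 2(m-1) = m + 2. Thus the coefficients of U are
polynomials in t, and t = 1 is allowed. -/

namespace SymTree

open MvPowerSeries

/-! ### Order estimates for power series. -/

section Order

variable {σ τ R S : Type*} [CommRing R] [CommRing S] [Algebra R S]

theorem le_order_sub {k : ℕ∞} {f g : MvPowerSeries σ R} (hf : k ≤ f.order) (hg : k ≤ g.order) :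
    k ≤ (f - g).order := by
  rw [sub_eq_add_neg]
  exact (le_min hf (by rwa [order_neg])).trans min_order_le_add

theorem le_order_sum {ι : Type*} (s : Finset ι) {k : ℕ∞} {f : ι → MvPowerSeries σ R}
    (h : ∀ i ∈ s, k ≤ (f i).order) : k ≤ (∑ i ∈ s, f i).order := by
  classical
  refine le_order fun d hd => ?_
  rw [map_sum]
  exact Finset.sum_eq_zero fun i hi => coeff_of_lt_order (hd.trans_le (h i hi))

theorem le_order_pderiv {k : ℕ} (i : σ) {f : MvPowerSeries σ R}
    (hf : ((k + 1 : ℕ) : ℕ∞) ≤ f.order) : (k : ℕ∞) ≤ (pderiv R i f).order := by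
  refine nat_le_order fun d hd => ?_
  rw [coeff_pderiv, coeff_of_lt_order, zero_mul]
  refine lt_of_lt_of_le ?_ hf
  rw [map_add, Finsupp.degree_single]
  exact_mod_cast Nat.add_lt_add_right hd 1

theorem le_order_subst_of_one_le {a : σ → MvPowerSeries τ S} (ha : HasSubst a)
    (h : ∀ i, 1 ≤ (a i).order) (f : MvPowerSeries σ R) : f.order ≤ (subst a f).order :=
  calc f.order = 1 * f.order := (one_mul _).symm
    _ ≤ (⨅ i, (a i).order) * f.order := by gcongr; exact le_iInf h
    _ ≤ _ := le_order_subst ha f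

theorem hasSubst_of_one_le_order [Finite σ] {a : σ → MvPowerSeries τ S}
    (h : ∀ i, 1 ≤ (a i).order) : HasSubst a :=
  hasSubst_of_constantCoeff_zero fun i => one_le_order_iff_constCoeff_eq_zero.1 (h i)

theorem eq_zero_of_forall_le_order {f : MvPowerSeries σ R} (h : ∀ k : ℕ, (k : ℕ∞) ≤ f.order) :
    f = 0 :=
  order_eq_top_iff.1 (ENat.eq_top_iff_forall_ge.2 h)

theorem one_le_order_X (i : σ) : 1 ≤ (X i : MvPowerSeries σ R).order :=
  one_le_order_iff_constCoeff_eq_zero.2 (by simp)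

end Order

/-! ### The chain rule, and derivations acting on coefficients. -/

section ChainRule

variable {σ τ R S : Type*} [CommRing R] [CommRing S] [Algebra R S]

theorem derivation_aeval [Fintype σ] {A : Type*} [CommRing A] [Algebra R A] (δ : Derivation R A A)
    (a : σ → A) (p : MvPolynomial σ R) :
    δ (MvPolynomial.aeval a p) = ∑ j, MvPolynomial.aeval a (MvPolynomial.pderiv j p) * δ (a j) := by
  classical
  induction p using MvPolynomial.induction_on with
  | C r => simp
  | add p q hp hq => simp [hp, hq, add_mul, Finset.sum_add_distrib]
  | mul_X p i hp =>
    simp only [map_mul, MvPolynomial.aeval_X, Derivation.leibniz, hp, smul_eq_mul, map_add,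
      add_mul, Finset.sum_add_distrib, MvPolynomial.pderiv_X, Pi.single_apply, Finset.mul_sum]
    congr 1
    · rw [Finset.sum_eq_single i] <;> simp +contextual [eq_comm]
    · exact Finset.sum_congr rfl fun j _ => by ring

/-- The chain rule for a derivation that lowers the order by at most one. -/
theorem derivation_subst [Fintype σ] (δ : Derivation R (MvPowerSeries τ S) (MvPowerSeries τ S))
    (hδ : ∀ (k : ℕ) (f : MvPowerSeries τ S), ((k + 1 : ℕ) : ℕ∞) ≤ f.order → (k : ℕ∞) ≤ (δ f).order)
    {a : σ → MvPowerSeries τ S} (ha : ∀ i, 1 ≤ (a i).order) (f : MvPowerSeries σ R) :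
    δ (subst a f) = ∑ j, subst a (pderiv R j f) * δ (a j) := by
  have hs := hasSubst_of_one_le_order ha
  have hord : ∀ g : MvPowerSeries σ R, g.order ≤ (subst a g).order := le_order_subst_of_one_le hs ha
  rw [← sub_eq_zero]
  refine eq_zero_of_forall_le_order fun k => ?_
  -- For the polynomial `p` the identity is exact. The remainder `g` has order at least k + 1, of
  -- which `δ` and the partial derivatives lose at most one.
  set p := f.truncTotal (k + 1) with hp
  set g := f - (p : MvPowerSeries σ R) with hg
  have hgo : ((k + 1 : ℕ) : ℕ∞) ≤ g.order := nat_le_order fun d hd => by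
    rw [hg, map_sub, MvPolynomial.coeff_coe, coeff_truncTotal _ hd, sub_self]
  have hf : f = p + g := by rw [hg]; ring
  have key : δ (subst a f) - ∑ j, subst a (pderiv R j f) * δ (a j) =
      δ (subst a g) - ∑ j, subst a (pderiv R j g) * δ (a j) := by
    rw [hf, subst_add hs, map_add, subst_coe, derivation_aeval]
    simp only [map_add, subst_add hs, add_mul, Finset.sum_add_distrib, pderiv_coe, subst_coe]
    ring
  rw [key]
  refine le_order_sub (hδ _ _ (hgo.trans (hord _))) (le_order_sum _ fun j _ => ?_)
  exact ((le_order_pderiv j hgo).trans (hord _)).trans (le_self_add.trans le_order_mul)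

/-- The derivation of a power series ring that acts on coefficients. -/
noncomputable def coeffDerivation (D : Derivation R S S) :
    Derivation R (MvPowerSeries τ S) (MvPowerSeries τ S) where
  toFun f := fun d => D (coeff d f)
  map_add' f g := by ext d; exact (congrArg D (map_add _ _ _)).trans (map_add D _ _)
  map_smul' r f := by ext d; exact D.map_smul r _
  map_one_eq_zero' := by
    classical
    ext d
    change D (coeff d 1) = 0
    rw [coeff_one]; split <;> simp
  leibniz' f g := by
    classical
    ext d
    change D (coeff d (f * g)) = coeff d (f * (show MvPowerSeries τ S from fun d => D (coeff d g)) +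
      g * (show MvPowerSeries τ S from fun d => D (coeff d f)))
    rw [map_add, coeff_mul, mul_comm g, coeff_mul, coeff_mul, map_sum, ← Finset.sum_add_distrib]
    refine Finset.sum_congr rfl fun x _ => ?_
    rw [Derivation.leibniz, smul_eq_mul, smul_eq_mul]
    change _ = coeff x.1 f * D (coeff x.2 g) + D (coeff x.1 f) * coeff x.2 g
    ring

@[simp]
theorem coeff_coeffDerivation (D : Derivation R S S) (f : MvPowerSeries τ S) (d : τ →₀ ℕ) :
    coeff d (coeffDerivation D f) = D (coeff d f) := rfl

theorem le_order_coeffDerivation (D : Derivation R S S) (f : MvPowerSeries τ S) :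
    f.order ≤ (coeffDerivation D f).order :=
  le_order fun d hd => by rw [coeff_coeffDerivation, coeff_of_lt_order hd, map_zero]

/-- A partial derivative multiplies coefficients by natural numbers, which `D` kills. -/
theorem coeffDerivation_pderiv (D : Derivation R S S) (i : τ) (f : MvPowerSeries τ S) :
    coeffDerivation D (pderiv S i f) = pderiv S i (coeffDerivation D f) := by
  ext d
  rw [coeff_coeffDerivation, coeff_pderiv, coeff_pderiv, coeff_coeffDerivation, Derivation.leibniz]
  have : D ((d i : S) + 1) = 0 := by
    rw [← Nat.cast_succ]; exact D.map_natCast _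
  rw [this, smul_zero, zero_add, smul_eq_mul, mul_comm]

theorem subst_map_algebraMap {a : σ → MvPowerSeries τ S} (ha : HasSubst a)
    (f : MvPowerSeries σ R) : subst a (map (algebraMap R S) f) = subst a f := by
  rw [map_algebraMap_eq_subst_X, subst_comp_subst_apply HasSubst.X ha]
  congr 1
  ext1 s
  exact subst_X ha s

/-- Used with S = R[t] and `h` the evaluation at a point, to specialise the parameter inside a
substitution. -/
theorem map_subst_of_comp_eq_id {a : σ → MvPowerSeries τ S} (ha : HasSubst a) (h : S →+* R)
    (hh : h.comp (algebraMap R S) = RingHom.id R) (f : MvPowerSeries σ R) :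
    map h (subst a f) = subst (fun i => map h (a i)) f := by
  rw [← subst_map_algebraMap ha, map_subst ha]
  congr 1
  ext d
  exact DFunLike.congr_fun hh (coeff d f)

end ChainRule

/-! ### Power series depending polynomially on t: transport and Burgers equations. -/

section Evolution

open Polynomial (evalRingHom)

variable {σ K : Type*} [CommRing K]

/-- Differentiation with respect to the parameter `t` of power series over `K[t]`. -/
noncomputable def paramDeriv (σ K : Type*) [CommRing K] :
    Derivation K (MvPowerSeries σ (Polynomial K)) (MvPowerSeries σ (Polynomial K)) :=
  coeffDerivation Polynomial.derivative'

theorem coeff_paramDeriv (f : MvPowerSeries σ (Polynomial K)) (d : σ →₀ ℕ) :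
    coeff d (paramDeriv σ K f) = Polynomial.derivative (coeff d f) := rfl

theorem le_order_paramDeriv (f : MvPowerSeries σ (Polynomial K)) :
    f.order ≤ (paramDeriv σ K f).order := le_order_coeffDerivation _ f

theorem paramDeriv_subst [Fintype σ] {a : σ → MvPowerSeries σ (Polynomial K)}
    (ha : ∀ i, 1 ≤ (a i).order) (f : MvPowerSeries σ K) :
    paramDeriv σ K (subst a f) = ∑ j, subst a (pderiv K j f) * paramDeriv σ K (a j) :=
  derivation_subst _ (fun k g hg => (le_trans (by exact_mod_cast k.le_succ) hg).trans
    (le_order_paramDeriv g)) ha f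

theorem pderiv_subst [Fintype σ] {S : Type*} [CommRing S] [Algebra K S]
    {a : σ → MvPowerSeries σ S} (ha : ∀ i, 1 ≤ (a i).order) (i : σ) (f : MvPowerSeries σ K) :
    pderiv S i (subst a f) = ∑ j, subst a (pderiv K j f) * pderiv S i (a j) :=
  derivation_subst ((pderiv S i).restrictScalars K) (fun _ _ hg => le_order_pderiv i hg) ha f

theorem evalRingHom_comp_algebraMap (x : K) :
    (evalRingHom x).comp (algebraMap K (Polynomial K)) = RingHom.id K := by
  ext; simp

theorem map_eval_subst [Finite σ] {a : σ → MvPowerSeries σ (Polynomial K)}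
    (ha : ∀ i, 1 ≤ (a i).order) (x : K) (f : MvPowerSeries σ K) :
    map (evalRingHom x) (subst a f) = subst (fun i => map (evalRingHom x) (a i)) f :=
  map_subst_of_comp_eq_id (hasSubst_of_one_le_order ha) _ (evalRingHom_comp_algebraMap x) f

/-- Over a ℚ-algebra m + 1 is a unit, so the derivative determines a polynomial up to its constant
term. -/
theorem coeff_succ_eq_zero_of_derivative [Algebra ℚ K] {p : Polynomial K} {m : ℕ}
    (h : (Polynomial.derivative p).coeff m = 0) : p.coeff (m + 1) = 0 := by
  rw [Polynomial.coeff_derivative] at h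
  have hu : IsUnit ((m : K) + 1) := by
    have : (m : K) + 1 = algebraMap ℚ K (m + 1) := by simp
    rw [this]
    exact (IsUnit.mk0 _ (by positivity)).map _
  exact hu.mul_left_eq_zero.1 h

/-- The zero series is the only solution of a linear transport equation with zero initial value. -/
theorem eq_zero_of_transport [Algebra ℚ K] [Fintype σ] {V : σ → MvPowerSeries σ (Polynomial K)}
    {E : MvPowerSeries σ (Polynomial K)}
    (h : paramDeriv σ K E = ∑ k, V k * pderiv (Polynomial K) k E)
    (h0 : map (evalRingHom 0) E = 0) : E = 0 := by
  classical
  -- The right side of `h` is linear in `E`: if t^j divides all coefficients of `E`, it divides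
  -- their t-derivatives. As the constant terms vanish, integration gains one power of t.
  have hdvd : ∀ (j : ℕ) (d : σ →₀ ℕ), (Polynomial.X : Polynomial K) ^ j ∣ coeff d E := by
    intro j
    induction j with
    | zero => simp
    | succ j ih =>
      intro d
      have hder : (Polynomial.X : Polynomial K) ^ j ∣ Polynomial.derivative (coeff d E) := by
        rw [← coeff_paramDeriv, h, map_sum]
        refine Finset.dvd_sum fun k _ => ?_
        rw [coeff_mul]
        refine Finset.dvd_sum fun x _ => Dvd.dvd.mul_left ?_ _
        rw [coeff_pderiv]
        exact (ih _).mul_right _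
      rw [Polynomial.X_pow_dvd_iff] at hder ⊢
      rintro (_ | m) hm
      · rw [Polynomial.coeff_zero_eq_eval_zero]
        simpa using congrArg (coeff d) h0
      · exact coeff_succ_eq_zero_of_derivative (hder m (Nat.lt_of_succ_lt_succ hm))
  ext d m
  simpa using Polynomial.X_pow_dvd_iff.1 (hdvd (m + 1) d) m m.lt_succ_self

/-- A solution of the inviscid Burgers equation with initial value `N` is given implicitly by
`V = N (X + t V)`. -/
theorem eq_subst_of_burgers [Algebra ℚ K] [Fintype σ] {V : σ → MvPowerSeries σ (Polynomial K)}
    {N : σ → MvPowerSeries σ K} (hV : ∀ i, 1 ≤ (V i).order)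
    (h : ∀ i, paramDeriv σ K (V i) = ∑ k, V k * pderiv (Polynomial K) k (V i))
    (h0 : ∀ i, map (evalRingHom 0) (V i) = N i) (i : σ) :
    V i = subst (fun j => X j + C Polynomial.X * V j) (N i) := by
  classical
  obtain ⟨G, hG⟩ : ∃ G : σ → MvPowerSeries σ (Polynomial K),
      G = fun j => X j + C Polynomial.X * V j := ⟨_, rfl⟩
  rw [← hG]
  replace hG : ∀ j, G j = X j + C Polynomial.X * V j := fun j => congrFun hG j
  have hGo : ∀ j, 1 ≤ (G j).order := fun j => hG j ▸
    (le_min (one_le_order_X j) ((hV j).trans (le_add_self.trans le_order_mul))).trans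
      min_order_le_add
  have hpX : ∀ k j, pderiv (Polynomial K) k (G j) =
      (if j = k then 1 else 0) + C Polynomial.X * pderiv (Polynomial K) k (V j) := by
    intro k j
    rw [hG, map_add, Derivation.leibniz, pderiv_C, smul_zero, add_zero, smul_eq_mul, pderiv_X,
      Pi.single_apply]
  have hpt : ∀ j, paramDeriv σ K (G j) = V j + C Polynomial.X * paramDeriv σ K (V j) := by
    intro j
    have h1 : paramDeriv σ K (X j) = 0 := by
      ext1 d
      rw [coeff_paramDeriv, coeff_X]
      split <;> simp
    have h2 : paramDeriv σ K (C Polynomial.X) = 1 := by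
      ext1 d
      rw [coeff_paramDeriv, coeff_C, coeff_one]
      split <;> simp
    rw [hG, map_add, Derivation.leibniz, h1, h2, smul_eq_mul, smul_eq_mul]
    ring
  -- The field `V` transports both sides. For N(G) this follows from the chain rule and ∂G_j/∂t =
  -- V_j + t ∂V_j/∂t = ∑_k V_k D_k G_j. At t = 0 they agree because G = X there.
  refine sub_eq_zero.1 (eq_zero_of_transport (V := V) ?_ ?_)
  · rw [map_sub, h, paramDeriv_subst hGo]
    simp only [map_sub, mul_sub, Finset.sum_sub_distrib]
    refine congrArg₂ _ rfl ?_
    simp only [pderiv_subst hGo, hpX, hpt, h]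
    simp only [mul_add, Finset.sum_add_distrib, Finset.mul_sum, mul_ite, mul_one, mul_zero,
      Finset.sum_ite_eq', Finset.mem_univ, if_true]
    refine congrArg₂ _ (Finset.sum_congr rfl fun k _ => mul_comm _ _) ?_
    rw [Finset.sum_comm]
    exact Finset.sum_congr rfl fun k _ => Finset.sum_congr rfl fun j _ => by ring
  · rw [map_sub, h0, map_eval_subst hGo, sub_eq_zero]
    have : (fun j => map (evalRingHom (0 : K)) (G j)) = X := by
      ext1 j
      simp [hG]
    rw [this, subst_self, id]

end Evolution

/-! ### Left cancellation under composition. -/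

section Cancellation

open Polynomial (evalRingHom)

variable {σ K : Type*} [CommRing K] [Algebra ℚ K]

/-- On the segment a = B + t(A - B), the t-derivative of f(a) is ∑ (D_j f)(a)(A_j - B_j), of order
at least 1 + k. The coefficients of f(a) in degree at most k are therefore constant in t; compare t
= 0 with t = 1. -/
theorem le_order_subst_sub_subst [Fintype σ] {A B : σ → MvPowerSeries σ K}
    (hA : ∀ i, 1 ≤ (A i).order) (hB : ∀ i, 1 ≤ (B i).order) {k : ℕ}
    (hAB : ∀ i, (k : ℕ∞) ≤ (A i - B i).order) {f : MvPowerSeries σ K} (hf : 2 ≤ f.order) :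
    ((k + 1 : ℕ) : ℕ∞) ≤ (subst A f - subst B f).order := by
  classical
  set a : σ → MvPowerSeries σ (Polynomial K) := fun i =>
    map (algebraMap K (Polynomial K)) (B i) +
      C Polynomial.X * map (algebraMap K (Polynomial K)) (A i - B i) with ha
  have hao : ∀ i, 1 ≤ (a i).order := fun i =>
    (le_min ((hB i).trans (le_order_map _)) (((le_order_sub (hA i) (hB i)).trans
      (le_order_map _)).trans (le_add_self.trans le_order_mul))).trans min_order_le_add
  have hpt : ∀ i, (k : ℕ∞) ≤ (paramDeriv σ K (a i)).order := by
    intro i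
    have : paramDeriv σ K (a i) = map (algebraMap K (Polynomial K)) (A i - B i) := by
      ext1 d
      rw [coeff_paramDeriv, ha]
      simp
    rw [this]
    exact (hAB i).trans (le_order_map _)
  have hder : ((k + 1 : ℕ) : ℕ∞) ≤ (paramDeriv σ K (subst a f)).order := by
    rw [paramDeriv_subst hao]
    refine le_order_sum _ fun j _ => ?_
    rw [add_comm k, Nat.cast_add]
    refine (add_le_add ?_ (hpt j)).trans le_order_mul
    exact (le_order_pderiv j hf).trans
      (le_order_subst_of_one_le (hasSubst_of_one_le_order hao) hao _)
  have hev : ∀ x : K, subst (fun i => B i + C x * (A i - B i)) f =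
      map (evalRingHom x) (subst a f) := by
    intro x
    rw [map_eval_subst hao]
    congr 1
    ext1 i
    have hid : ∀ g : MvPowerSeries σ K,
        map (evalRingHom x) (map (algebraMap K (Polynomial K)) g) = g := by
      intro g; ext d; simp
    simp only [ha, map_add, map_mul, hid, map_C]
    simp
  refine nat_le_order fun d hd => ?_
  have h1 := congrArg (coeff d) (hev 1)
  have h0 := congrArg (coeff d) (hev 0)
  simp only [map_one, map_zero, one_mul, zero_mul, add_zero, add_sub_cancel, coeff_map] at h1 h0
  have hc : coeff d (subst a f) = Polynomial.C ((coeff d (subst a f)).coeff 0) := by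
    ext (_ | m)
    · simp
    · rw [Polynomial.coeff_C_succ]
      refine coeff_succ_eq_zero_of_derivative ?_
      rw [← coeff_paramDeriv, coeff_of_lt_order (lt_of_lt_of_le (by exact_mod_cast hd) hder)]
      simp
  rw [map_sub, h1, h0, hc]
  simp

/-- Maps of the form identity plus higher order terms are left cancellable under composition. -/
theorem eq_of_subst_eq [Fintype σ] {F A B : σ → MvPowerSeries σ K}
    (hF : ∀ i, 2 ≤ (X i - F i).order) (hA : ∀ i, 1 ≤ (A i).order) (hB : ∀ i, 1 ≤ (B i).order)
    (h : ∀ i, subst A (F i) = subst B (F i)) : A = B := by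
  -- Since X - F has order at least 2, this identity improves agreement of `A` and `B` to order k
  -- into order k + 1.
  have key : ∀ i, A i - B i = subst A (X i - F i) - subst B (X i - F i) := by
    intro i
    have hsA := hasSubst_of_one_le_order hA
    have hsB := hasSubst_of_one_le_order hB
    rw [subst_sub hsA, subst_sub hsB, subst_X hsA, subst_X hsB, h i]
    ring
  have : ∀ (k : ℕ) (i), (k : ℕ∞) ≤ (A i - B i).order := by
    intro k
    induction k with
    | zero => simp
    | succ k ih => exact fun i => (key i) ▸ le_order_subst_sub_subst hA hB ih (hF i)
  ext1 i
  exact sub_eq_zero.1 (eq_zero_of_forall_le_order fun k => this k i)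

end Cancellation

/-! ### From the edge-cutting recursion to the fixed-point equation. -/

section Recursion

open Polynomial (evalRingHom)

variable {σ K : Type*} [CommRing K]

theorem coeff_coeff_pderiv {U : MvPowerSeries σ (Polynomial K)} {q : ℕ → MvPowerSeries σ K}
    (hU : ∀ d j, (coeff d U).coeff j = coeff d (q j)) (i : σ) (d : σ →₀ ℕ) (j : ℕ) :
    (coeff d (pderiv (Polynomial K) i U)).coeff j = coeff d (pderiv K i (q j)) := by
  rw [coeff_pderiv, coeff_pderiv, ← hU, ← Nat.cast_succ, ← Nat.cast_succ,
    Polynomial.coeff_mul_natCast]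

/-- The Hamilton–Jacobi equation for a generating function, from the recursion between its
terms. -/
theorem paramDeriv_of_recursion [Fintype σ] {U : MvPowerSeries σ (Polynomial K)}
    {q : ℕ → MvPowerSeries σ K} (hU : ∀ d j, (coeff d U).coeff j = coeff d (q j))
    (hrec : ∀ j, (2 * (j + 1)) • q (j + 1) =
      ∑ i, ∑ x ∈ Finset.HasAntidiagonal.antidiagonal j, pderiv K i (q x.1) * pderiv K i (q x.2)) :
    2 • paramDeriv σ K U =
      ∑ i, pderiv (Polynomial K) i U * pderiv (Polynomial K) i U := by
  classical
  ext d j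
  have h := congrArg (coeff d) (hrec j)
  simp only [map_sum, coeff_mul, map_nsmul] at h ⊢
  rw [coeff_paramDeriv, Polynomial.coeff_smul, Polynomial.coeff_derivative, hU,
    Polynomial.finsetSum_coeff]
  calc 2 • (coeff d (q (j + 1)) * ((j : K) + 1)) = (2 * (j + 1)) • coeff d (q (j + 1)) := by
        simp only [nsmul_eq_mul]; push_cast; ring
    _ = _ := h
    _ = _ := ?_
  refine Finset.sum_congr rfl fun i _ => ?_
  rw [Polynomial.finsetSum_coeff, Finset.sum_comm]
  refine Finset.sum_congr rfl fun x _ => ?_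
  rw [Polynomial.coeff_mul]
  exact Finset.sum_congr rfl fun y _ => by
    rw [coeff_coeff_pderiv hU, coeff_coeff_pderiv hU]

theorem pderiv_pderiv_comm (i j : σ) (f : MvPowerSeries σ K) :
    pderiv K i (pderiv K j f) = pderiv K j (pderiv K i f) := by
  ext d
  rw [coeff_pderiv, coeff_pderiv, coeff_pderiv, coeff_pderiv, add_right_comm]
  by_cases h : i = j
  · subst h; rfl
  · simp [Finsupp.single_eq_of_ne h, Finsupp.single_eq_of_ne (Ne.symm h)]
    ring

theorem nsmul_injective_mvPowerSeries [Algebra ℚ K] {m : ℕ} (hm : m ≠ 0)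
    {f g : MvPowerSeries σ K} (h : m • f = m • g) : f = g := by
  have := congrArg (fun f => ((m : ℚ)⁻¹) • f) h
  simpa only [← Nat.cast_smul_eq_nsmul ℚ, smul_smul,
    inv_mul_cancel₀ (Nat.cast_ne_zero.2 hm : (m : ℚ) ≠ 0), one_smul] using this

/-- If the terms of a series `S = ∑ q j` satisfy the edge-cutting recursion, then the gradient of
`S` is the fixed point of the gradient of `q 0` translated by it. -/
theorem pderiv_eq_subst_of_recursion [Algebra ℚ K] [Fintype σ] {q : ℕ → MvPowerSeries σ K}
    (h0 : ∀ i, 2 ≤ (pderiv K i (q 0)).order)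
    (hord : ∀ j, ((j + 4 : ℕ) : ℕ∞) ≤ (q (j + 1)).order)
    (hrec : ∀ j, (2 * (j + 1)) • q (j + 1) =
      ∑ i, ∑ x ∈ Finset.HasAntidiagonal.antidiagonal j, pderiv K i (q x.1) * pderiv K i (q x.2))
    {S : MvPowerSeries σ K}
    (hS : ∀ d, coeff d S = ∑ j ∈ Finset.range (d.degree + 1), coeff d (q j)) :
    (∀ i, 2 ≤ (pderiv K i S).order) ∧
      ∀ i, pderiv K i S = subst (fun j => X j + pderiv K j S) (pderiv K i (q 0)) := by
  classical
  -- U = ∑ t^j q_j. By `hord` the terms with j > |d| do not reach the monomial d, so the cut-off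
  -- loses nothing and the coefficients are polynomials in t.
  obtain ⟨U, hU'⟩ : ∃ U : MvPowerSeries σ (Polynomial K), ∀ d, coeff d U =
      ∑ j ∈ Finset.range (d.degree + 1), Polynomial.monomial j (coeff d (q j)) :=
    ⟨fun d => ∑ j ∈ Finset.range (d.degree + 1), Polynomial.monomial j (coeff d (q j)),
      fun _ => rfl⟩
  have hU : ∀ d j, (coeff d U).coeff j = coeff d (q j) := by
    intro d j
    rw [hU', Polynomial.finsetSum_coeff]
    simp only [Polynomial.coeff_monomial, Finset.sum_ite_eq', Finset.mem_range]
    split_ifs with hj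
    · rfl
    · obtain ⟨j, rfl⟩ : ∃ k, j = k + 1 := ⟨j - 1, by omega⟩
      refine (coeff_of_lt_order (lt_of_lt_of_le ?_ (hord j))).symm
      exact_mod_cast (by omega : d.degree < j + 4)
  have hUS : map (evalRingHom 1) U = S := by
    ext d
    rw [coeff_map, hU', hS]
    simp
  have hmap : ∀ (x : K) (f : MvPowerSeries σ (Polynomial K)) (i : σ),
      map (evalRingHom x) (pderiv (Polynomial K) i f) = pderiv K i (map (evalRingHom x) f) := by
    intro x f i
    ext d
    simp [coeff_pderiv]
  have hVo : ∀ i, 2 ≤ (pderiv (Polynomial K) i U).order := by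
    intro i
    refine nat_le_order (n := 2) fun d hd => ?_
    ext j
    rw [coeff_coeff_pderiv hU, Polynomial.coeff_zero]
    have hd' : (d.degree : ℕ∞) < 2 := by exact_mod_cast hd
    refine coeff_of_lt_order (hd'.trans_le ?_)
    cases j with
    | zero => exact h0 i
    | succ j => exact le_order_pderiv (k := 2) i (le_trans (by exact_mod_cast (by omega)) (hord j))
  -- Apply D_i to the Hamilton–Jacobi equation, use symmetry of second derivatives and cancel the
  -- factor 2.
  have hburgers : ∀ i, paramDeriv σ K (pderiv (Polynomial K) i U) = ∑ k,
      pderiv (Polynomial K) k U * pderiv (Polynomial K) k (pderiv (Polynomial K) i U) := by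
    intro i
    have h := congrArg (pderiv (Polynomial K) i) (paramDeriv_of_recursion hU hrec)
    have hc : paramDeriv σ K (pderiv (Polynomial K) i U) =
        pderiv (Polynomial K) i (paramDeriv σ K U) := coeffDerivation_pderiv _ i U
    rw [map_nsmul, ← hc, map_sum] at h
    refine nsmul_injective_mvPowerSeries two_ne_zero (h.trans ?_)
    rw [Finset.smul_sum]
    refine Finset.sum_congr rfl fun k _ => ?_
    rw [Derivation.leibniz, smul_eq_mul, pderiv_pderiv_comm i k, two_nsmul]
  have key := eq_subst_of_burgers (V := fun i => pderiv (Polynomial K) i U)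
    (N := fun i => pderiv K i (q 0)) (fun i => le_trans (by norm_num) (hVo i)) hburgers (by
      intro i
      ext d
      rw [coeff_map, Polynomial.coe_evalRingHom, ← Polynomial.coeff_zero_eq_eval_zero,
        coeff_coeff_pderiv hU])
  have hGo : ∀ j, 1 ≤ (X j + C Polynomial.X * pderiv (Polynomial K) j U).order := fun j =>
    (le_min (one_le_order_X j) ((le_trans (by norm_num) (hVo j)).trans
      (le_add_self.trans le_order_mul))).trans min_order_le_add
  refine ⟨fun i => ?_, fun i => ?_⟩
  · rw [← hUS, ← hmap]
    exact (hVo i).trans (le_order_map _)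
  · have h := congrArg (map (evalRingHom 1)) (key i)
    rw [map_eval_subst hGo, hmap, hUS] at h
    rw [h]
    congr 1
    ext1 j
    rw [map_add, map_mul, map_C, map_X, hmap, hUS]
    simp

end Recursion

/-! ### Half-edges, and joining two graphs by an edge. -/

section Marked

variable {n : ℕ} {K : Type*} [CommRing K]

theorem derivation_prod {ι R A : Type*} [CommRing R] [CommRing A] [Algebra R A] [DecidableEq ι]
    (D : Derivation R A A) (s : Finset ι) (f : ι → A) :
    D (∏ v ∈ s, f v) = ∑ u ∈ s, ∏ v ∈ s, if v = u then D (f v) else f v := by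
  induction s using Finset.induction_on with
  | empty => simp
  | insert x s hx ih =>
    rw [Finset.prod_insert hx, Derivation.leibniz, ih, Finset.sum_insert hx,
      Finset.prod_insert hx, if_pos rfl, add_comm, smul_eq_mul, smul_eq_mul, Finset.mul_sum,
      mul_comm]
    congr 1
    · congr 1
      refine Finset.prod_congr rfl fun v hv => (if_neg ?_).symm
      rintro rfl; exact hx hv
    · refine Finset.sum_congr rfl fun u hu => ?_
      rw [Finset.prod_insert hx, if_neg]
      rintro rfl; exact hx hu

open Classical in
/-- The term of a graph with a half-edge labelled `i` attached to the vertex `u`. -/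
noncomputable def markedTerm {V : Type*} [Fintype V] (T : SimpleGraph V) (u : V) (i : Fin n)
    (P : MvPowerSeries (Fin n) K) : MvPowerSeries (Fin n) K :=
  ∑ l : T.edgeSet → Fin n, ∏ v : V, iterPderiv ((if v = u then {i} else 0) + adjLabels T l v) P

theorem iterPderiv_singleton_add (i : Fin n) (s : Multiset (Fin n))
    (P : MvPowerSeries (Fin n) K) :
    iterPderiv ({i} + s) P = pderiv K i (iterPderiv s P) := by
  rw [Multiset.singleton_add, iterPderiv, Multiset.foldr_cons, iterPderiv]

/-- By the Leibniz rule D_i falls on one vertex factor at a time, which is the effect of a half-edge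
labelled i. -/
theorem pderiv_graphTerm {V : Type*} [Fintype V] (T : SimpleGraph V) (i : Fin n)
    (P : MvPowerSeries (Fin n) K) :
    pderiv K i (graphTerm T P) = ∑ u, markedTerm T u i P := by
  classical
  unfold graphTerm markedTerm
  rw [map_sum, Finset.sum_comm]
  refine Finset.sum_congr rfl fun l _ => ?_
  rw [derivation_prod]
  refine Finset.sum_congr rfl fun u _ => Finset.prod_congr rfl fun v _ => ?_
  by_cases h : v = u
  · simp only [if_pos h, iterPderiv_singleton_add]
  · simp only [if_neg h, zero_add]

open Classical in
theorem adjLabels_eq_sum {V ι : Type*} [Fintype V] [Fintype ι] (T : SimpleGraph V)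
    (ε : ι ≃ T.edgeSet) (l : T.edgeSet → Fin n) (v : V) :
    adjLabels T l v = ∑ e, if v ∈ (ε e : Sym2 V) then {l (ε e)} else 0 := by
  unfold adjLabels
  rw [Equiv.sum_comp ε (fun e => if v ∈ (e : Sym2 V) then ({l e} : Multiset (Fin n)) else 0),
    ← Finset.sum_filter]
  conv_lhs => rw [← Multiset.sum_map_singleton (Multiset.map _ _), Multiset.map_map]
  rfl

/-- The graph obtained from disjoint graphs by joining a vertex of one to a vertex of the other. -/
def joinGraph {A B : Type*} (G : SimpleGraph A) (H : SimpleGraph B) (a : A) (b : B) :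
    SimpleGraph (A ⊕ B) :=
  (G ⊕g H) ⊔ SimpleGraph.edge (.inl a) (.inr b)

variable {A B : Type*} {G : SimpleGraph A} {H : SimpleGraph B} {a : A} {b : B}

@[simp] theorem joinGraph_adj_inl_inl {x y : A} :
    (joinGraph G H a b).Adj (.inl x) (.inl y) ↔ G.Adj x y := by
  simp [joinGraph, SimpleGraph.edge_adj]

@[simp] theorem joinGraph_adj_inr_inr {x y : B} :
    (joinGraph G H a b).Adj (.inr x) (.inr y) ↔ H.Adj x y := by
  simp [joinGraph, SimpleGraph.edge_adj]

@[simp] theorem joinGraph_adj_inl_inr {x : A} {y : B} :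
    (joinGraph G H a b).Adj (.inl x) (.inr y) ↔ x = a ∧ y = b := by
  simp [joinGraph, SimpleGraph.edge_adj]

@[simp] theorem joinGraph_adj_inr_inl {x : A} {y : B} :
    (joinGraph G H a b).Adj (.inr y) (.inl x) ↔ x = a ∧ y = b := by
  rw [SimpleGraph.adj_comm, joinGraph_adj_inl_inr]

/-- The edges of a joined graph. -/
def joinEdge (G : SimpleGraph A) (H : SimpleGraph B) (a : A) (b : B) :
    Option (G.edgeSet ⊕ H.edgeSet) → (joinGraph G H a b).edgeSet
  | none => ⟨s(.inl a, .inr b), by simp⟩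
  | some (.inl e) => ⟨(e : Sym2 A).map .inl, by
      obtain ⟨e, he⟩ := e
      induction e using Sym2.ind
      simpa using he⟩
  | some (.inr e) => ⟨(e : Sym2 B).map .inr, by
      obtain ⟨e, he⟩ := e
      induction e using Sym2.ind
      simpa using he⟩

theorem joinEdge_bijective (G : SimpleGraph A) (H : SimpleGraph B) (a : A) (b : B) :
    Function.Bijective (joinEdge G H a b) := by
  constructor
  · rintro (_ | ⟨⟨x, y⟩, hx⟩ | ⟨⟨x, y⟩, hx⟩) (_ | ⟨⟨z, w⟩, hz⟩ | ⟨⟨z, w⟩, hz⟩) h <;>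
      simp_all [joinEdge]
  · rintro ⟨⟨x | x, y | y⟩, h⟩
    · exact ⟨some (.inl ⟨s(x, y), by simpa using h⟩), rfl⟩
    · obtain ⟨rfl, rfl⟩ := joinGraph_adj_inl_inr.1 h
      exact ⟨none, rfl⟩
    · obtain ⟨rfl, rfl⟩ := joinGraph_adj_inr_inl.1 h
      exact ⟨none, Subtype.ext Sym2.eq_swap⟩
    · exact ⟨some (.inr ⟨s(x, y), by simpa using h⟩), rfl⟩

/-- The edges of a joined graph are those of its parts and the joining edge. -/
noncomputable def joinEdgeEquiv (G : SimpleGraph A) (H : SimpleGraph B) (a : A) (b : B) :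
    Option (G.edgeSet ⊕ H.edgeSet) ≃ (joinGraph G H a b).edgeSet :=
  Equiv.ofBijective _ (joinEdge_bijective G H a b)

theorem isTree_joinGraph [Finite A] [Finite B] (hG : G.IsTree) (hH : H.IsTree) (a : A) (b : B) :
    (joinGraph G H a b).IsTree := by
  rw [SimpleGraph.isTree_iff_connected_and_card] at hG hH ⊢
  refine ⟨hG.1.sum_sup_edge hH.1, ?_⟩
  rw [← Nat.card_congr (joinEdgeEquiv G H a b), Finite.card_option, Nat.card_sum, Nat.card_sum,
    ← hG.2, ← hH.2]
  omega

open Classical in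
theorem adjLabels_joinGraph_inl [Fintype A] [Fintype B] (l : (joinGraph G H a b).edgeSet → Fin n)
    (x : A) :
    adjLabels (joinGraph G H a b) l (.inl x) =
      (if x = a then {l (joinEdge G H a b none)} else 0) +
        adjLabels G (fun e => l (joinEdge G H a b (some (.inl e)))) x := by
  rw [adjLabels_eq_sum _ (joinEdgeEquiv G H a b), Fintype.sum_option, Fintype.sum_sum_type,
    adjLabels_eq_sum _ (Equiv.refl _)]
  simp only [joinEdgeEquiv, joinEdge, Equiv.ofBijective_apply, Equiv.refl_apply]
  simp
  congr!

open Classical in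
theorem adjLabels_joinGraph_inr [Fintype A] [Fintype B] (l : (joinGraph G H a b).edgeSet → Fin n)
    (y : B) :
    adjLabels (joinGraph G H a b) l (.inr y) =
      (if y = b then {l (joinEdge G H a b none)} else 0) +
        adjLabels H (fun e => l (joinEdge G H a b (some (.inr e)))) y := by
  rw [adjLabels_eq_sum _ (joinEdgeEquiv G H a b), Fintype.sum_option, Fintype.sum_sum_type,
    adjLabels_eq_sum _ (Equiv.refl _)]
  simp only [joinEdgeEquiv, joinEdge, Equiv.ofBijective_apply, Equiv.refl_apply]
  simp
  congr!

/-- Labellings of a joined graph. -/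
noncomputable def joinLabelEquiv (G : SimpleGraph A) (H : SimpleGraph B) (a : A) (b : B) (L : Type*) :
    ((joinGraph G H a b).edgeSet → L) ≃ L × (G.edgeSet → L) × (H.edgeSet → L) :=
  ((joinEdgeEquiv G H a b).symm.arrowCongr (Equiv.refl L)).trans
    (Equiv.piOptionEquivProd.trans
      ((Equiv.refl L).prodCongr (Equiv.sumArrowEquivProdArrow _ _ _)))

/-- Once the label i of the joining edge is fixed, each side sees that edge only as a half-edge
labelled i, and the sum over the other labels factors. -/
theorem graphTerm_joinGraph [Fintype A] [Fintype B] (G : SimpleGraph A) (H : SimpleGraph B)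
    (a : A) (b : B) (P : MvPowerSeries (Fin n) K) :
    graphTerm (joinGraph G H a b) P = ∑ i, markedTerm G a i P * markedTerm H b i P := by
  classical
  have h : graphTerm (joinGraph G H a b) P = ∑ q : Fin n × (G.edgeSet → Fin n) × (H.edgeSet → Fin n),
      ∏ v, iterPderiv (adjLabels _ ((joinLabelEquiv G H a b (Fin n)).symm q) v) P :=
    Finset.sum_equiv (joinLabelEquiv G H a b (Fin n)) (by simp) fun l _ => by
      rw [Equiv.symm_apply_apply]
  rw [h, Fintype.sum_prod_type]
  refine Finset.sum_congr rfl fun i _ => ?_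
  rw [markedTerm, markedTerm, Finset.sum_mul_sum, Fintype.sum_prod_type]
  refine Finset.sum_congr (by congr!) fun l₁ _ => Finset.sum_congr (by congr!) fun l₂ _ => ?_
  obtain ⟨l, hl⟩ := (joinLabelEquiv G H a b (Fin n)).surjective (i, l₁, l₂)
  rw [← hl, Equiv.symm_apply_apply, Fintype.prod_sum_type]
  obtain ⟨rfl, hl⟩ := Prod.ext_iff.1 hl
  obtain ⟨rfl, rfl⟩ := Prod.ext_iff.1 hl
  refine congrArg₂ _ (Finset.prod_congr rfl fun x _ => ?_) (Finset.prod_congr rfl fun x _ => ?_)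
  · rw [adjLabels_joinGraph_inl]; rfl
  · rw [adjLabels_joinGraph_inr]; rfl

end Marked

/-! ### Cutting trees at an edge and glueing them back. -/

section Cutting

/-- Allows maps that collapse edges, such as the retraction of a tree onto a part that sends
everything outside to the attaching vertex. -/
theorem reachable_of_adj_imp {V W : Type*} {G : SimpleGraph V} {H : SimpleGraph W} (f : V → W)
    (h : ∀ x y, G.Adj x y → H.Reachable (f x) (f y)) {x y : V} (hxy : G.Reachable x y) :
    H.Reachable (f x) (f y) := by
  obtain ⟨p⟩ := hxy
  induction p with
  | nil => rfl
  | cons hadj _ ih => exact (h _ _ hadj).trans ih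

/-- A part of a tree that is attached to its complement at one vertex only is a tree. -/
theorem isTree_comap_of_cut {V : Type*} {T : SimpleGraph V} (hT : T.IsTree) {p : V → Prop} {a : V}
    (ha : p a) (hcut : ∀ x y, p x → ¬ p y → T.Adj x y → x = a) :
    (T.comap (Subtype.val : {x // p x} → V)).IsTree := by
  classical
  refine ⟨(SimpleGraph.connected_iff _).2 ⟨fun x y => ?_, ⟨⟨a, ha⟩⟩⟩,
    hT.isAcyclic.of_comap (Function.Embedding.subtype p)⟩
  have := reachable_of_adj_imp (H := T.comap (Subtype.val : {x // p x} → V))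
    (fun x => if h : p x then ⟨x, h⟩ else ⟨a, ha⟩) (fun x y hxy => ?_)
    (hT.connected.preconnected x.1 y.1)
  · simpa [x.2, y.2] using this
  · by_cases hx : p x <;> by_cases hy : p y
    · simp only [hx, hy, dif_pos]
      exact SimpleGraph.Adj.reachable hxy
    · obtain rfl := hcut x y hx hy hxy
      simp [hx, hy]
    · obtain rfl := hcut y x hy hx hxy.symm
      simp [hx, hy]
    · simp [hx, hy]

/-- Recovers one side of a glued tree as the component of the tail of the deleted edge; this makes
glueing injective. -/
theorem reachable_deleteEdges_iff_of_cut {V : Type*} {T : SimpleGraph V} (hT : T.Connected)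
    {p : V → Prop} {a b : V} (ha : p a) (hb : ¬ p b)
    (hcut : ∀ x y, p x → ¬ p y → T.Adj x y → x = a ∧ y = b) (x : V) :
    (T.deleteEdges {s(a, b)}).Reachable a x ↔ p x := by
  classical
  constructor
  · rintro ⟨w⟩
    by_contra hx
    obtain ⟨d, -, h1, h2⟩ := w.exists_boundary_dart {x | p x} ha hx
    have hadj := (SimpleGraph.deleteEdges_adj.1 d.adj)
    obtain ⟨h3, h4⟩ := hcut _ _ h1 h2 hadj.1
    exact hadj.2 (by rw [h3, h4]; rfl)
  · intro hx
    have := reachable_of_adj_imp (H := T.deleteEdges {s(a, b)})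
      (fun x => if p x then x else a) (fun x y hxy => ?_) (hT.preconnected a x)
    · simpa [hx, ha] using this
    · by_cases hx : p x <;> by_cases hy : p y
      · simp only [hx, hy, if_true]
        refine SimpleGraph.Adj.reachable (SimpleGraph.deleteEdges_adj.2 ⟨hxy, ?_⟩)
        simp only [Set.mem_singleton_iff, Sym2.eq_iff]
        rintro (⟨-, rfl⟩ | ⟨rfl, -⟩) <;> contradiction
      · obtain ⟨rfl, -⟩ := hcut x y hx hy hxy
        simp [hx, hy]
      · obtain ⟨rfl, -⟩ := hcut y x hy hx hxy.symm
        simp [hx, hy]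
      · simp [hx, hy]

/-- Every edge of a tree is a bridge. Its removal yields the cut needed for surjectivity of glueing.
-/
theorem cut_of_isTree {V : Type*} {T : SimpleGraph V} (hT : T.IsTree) {a b : V}
    (hab : T.Adj a b) :
    ¬ (T.deleteEdges {s(a, b)}).Reachable a b ∧
    ∀ x y, (T.deleteEdges {s(a, b)}).Reachable a x → ¬ (T.deleteEdges {s(a, b)}).Reachable a y →
      T.Adj x y → x = a ∧ y = b := by
  refine ⟨SimpleGraph.isBridge_iff.1 (SimpleGraph.isAcyclic_iff_forall_isBridge.1 hT.isAcyclic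
    ((SimpleGraph.mem_edgeSet T).2 hab)), fun x y hx hy hxy => ?_⟩
  by_cases h : s(x, y) = s(a, b)
  · rcases Sym2.eq_iff.1 h with h | ⟨-, rfl⟩
    · exact h
    · exact absurd (SimpleGraph.Reachable.refl _) hy
  · exact absurd (hx.trans (SimpleGraph.Adj.reachable (SimpleGraph.deleteEdges_adj.2 ⟨hxy, h⟩))) hy

/-- The trees with vertex set `V`. -/
abbrev LabelledTree (V : Type*) : Type _ := {T : SimpleGraph V // T.IsTree}

noncomputable instance {V : Type*} [Finite V] : Fintype (LabelledTree V) := Fintype.ofFinite _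

/-- A tree on each of two complementary sets of vertices, with a vertex in each. -/
abbrev SplitTree (V : Type*) : Type _ :=
  Σ S : Finset V, (LabelledTree {x // x ∈ S} × LabelledTree {x // x ∉ S}) ×
    ({x // x ∈ S} × {x // x ∉ S})

/-- A tree with an oriented edge. -/
abbrev DartTree (V : Type*) : Type _ :=
  {q : SimpleGraph V × V × V // q.1.IsTree ∧ q.1.Adj q.2.1 q.2.2}

variable {V : Type*}

open Classical in
/-- The graph on `V` obtained by joining graphs on complementary sets of vertices by an edge. -/
noncomputable def glue {S : Finset V} (G : SimpleGraph {x // x ∈ S})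
    (H : SimpleGraph {x // x ∉ S}) (a : {x // x ∈ S}) (b : {x // x ∉ S}) : SimpleGraph V :=
  (joinGraph G H a b).comap (Equiv.sumCompl (· ∈ S)).symm

open Classical in
/-- Glueing is isomorphic to joining the disjoint graphs. -/
noncomputable def glueIso {S : Finset V} (G : SimpleGraph {x // x ∈ S})
    (H : SimpleGraph {x // x ∉ S}) (a : {x // x ∈ S}) (b : {x // x ∉ S}) :
    glue G H a b ≃g joinGraph G H a b :=
  SimpleGraph.Iso.comap _ _

section glue

variable {S : Finset V} {G : SimpleGraph {x // x ∈ S}} {H : SimpleGraph {x // x ∉ S}}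
  {a : {x // x ∈ S}} {b : {x // x ∉ S}} {x y : V}

theorem glue_adj_mem_mem (hx : x ∈ S) (hy : y ∈ S) :
    (glue G H a b).Adj x y ↔ G.Adj ⟨x, hx⟩ ⟨y, hy⟩ := by
  classical
  rw [glue, SimpleGraph.comap_adj, Equiv.sumCompl_symm_apply_of_pos hx,
    Equiv.sumCompl_symm_apply_of_pos hy, joinGraph_adj_inl_inl]

theorem glue_adj_notMem_notMem (hx : x ∉ S) (hy : y ∉ S) :
    (glue G H a b).Adj x y ↔ H.Adj ⟨x, hx⟩ ⟨y, hy⟩ := by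
  classical
  rw [glue, SimpleGraph.comap_adj, Equiv.sumCompl_symm_apply_of_neg hx,
    Equiv.sumCompl_symm_apply_of_neg hy, joinGraph_adj_inr_inr]

theorem glue_adj_mem_notMem (hx : x ∈ S) (hy : y ∉ S) :
    (glue G H a b).Adj x y ↔ x = a ∧ y = b := by
  classical
  rw [glue, SimpleGraph.comap_adj, Equiv.sumCompl_symm_apply_of_pos hx,
    Equiv.sumCompl_symm_apply_of_neg hy, joinGraph_adj_inl_inr, Subtype.ext_iff, Subtype.ext_iff]

end glue

/-- Glueing the two parts of a split tree gives a tree with an oriented edge. -/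
noncomputable def SplitTree.glue [Finite V] (q : SplitTree V) : DartTree V :=
  ⟨(SymTree.glue q.2.1.1.1 q.2.1.2.1 q.2.2.1 q.2.2.2, q.2.2.1, q.2.2.2),
    (glueIso _ _ _ _).isTree_iff.2 (isTree_joinGraph q.2.1.1.2 q.2.1.2.2 _ _),
    (glue_adj_mem_notMem q.2.2.1.2 q.2.2.2.2).2 ⟨rfl, rfl⟩⟩

theorem SplitTree.mem_iff_reachable [Finite V] (q : SplitTree V) (x : V) :
    (q.glue.1.1.deleteEdges {s(q.glue.1.2.1, q.glue.1.2.2)}).Reachable q.glue.1.2.1 x ↔ x ∈ q.1 :=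
  reachable_deleteEdges_iff_of_cut q.glue.2.1.connected (p := (· ∈ q.1)) q.2.2.1.2 q.2.2.2.2
    (fun _ _ hx hy => (glue_adj_mem_notMem hx hy).1) x

theorem SplitTree.glue_bijective [Finite V] : Function.Bijective (SplitTree.glue (V := V)) := by
  classical
  have := Fintype.ofFinite V
  constructor
  · intro q q' h
    have hS : q.1 = q'.1 := by
      ext x
      rw [← q.mem_iff_reachable, ← q'.mem_iff_reachable, h]
    obtain ⟨S, ⟨⟨G, hG⟩, ⟨H, hH⟩⟩, a, b⟩ := q
    obtain ⟨S', ⟨⟨G', hG'⟩, ⟨H', hH'⟩⟩, a', b'⟩ := q'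
    obtain rfl : S = S' := hS
    have h1 := congrArg (fun q : DartTree V => q.1.1) h
    have h2 := congrArg (fun q : DartTree V => q.1.2.1) h
    have h3 := congrArg (fun q : DartTree V => q.1.2.2) h
    dsimp only [SplitTree.glue] at h1 h2 h3
    obtain rfl : G = G' := by
      ext x y
      rw [← glue_adj_mem_mem (H := H) (a := a) (b := b) x.2 y.2, h1, glue_adj_mem_mem]
    obtain rfl : H = H' := by
      ext x y
      rw [← glue_adj_notMem_notMem (G := G) (a := a) (b := b) x.2 y.2, h1, glue_adj_notMem_notMem]
    obtain rfl := Subtype.ext h2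
    obtain rfl := Subtype.ext h3
    rfl
  · rintro ⟨⟨T, a, b⟩, hT, hab⟩
    dsimp only at hT hab
    obtain ⟨hb, hcut⟩ := cut_of_isTree hT hab
    set S : Finset V := {x | (T.deleteEdges {s(a, b)}).Reachable a x} with hS
    have hmem : ∀ x, x ∈ S ↔ (T.deleteEdges {s(a, b)}).Reachable a x := by simp [hS]
    simp only [← hmem] at hb hcut
    have ha : a ∈ S := (hmem a).2 (SimpleGraph.Reachable.refl a)
    refine ⟨⟨S, ⟨⟨_, isTree_comap_of_cut hT ha fun x y hx hy h => (hcut x y hx hy h).1⟩,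
      ⟨_, isTree_comap_of_cut hT hb fun x y hx hy h =>
        (hcut y x (not_not.1 hy) hx h.symm).2⟩⟩, ⟨a, ha⟩, ⟨b, hb⟩⟩, Subtype.ext ?_⟩
    refine Prod.ext ?_ rfl
    ext x y
    dsimp only [SplitTree.glue]
    by_cases hx : x ∈ S <;> by_cases hy : y ∈ S
    · rw [glue_adj_mem_mem hx hy]; rfl
    · rw [glue_adj_mem_notMem hx hy]
      exact ⟨fun ⟨h, h'⟩ => by rw [h, h']; exact hab, hcut x y hx hy⟩
    · rw [SimpleGraph.adj_comm, glue_adj_mem_notMem hy hx, SimpleGraph.adj_comm]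
      exact ⟨fun ⟨h, h'⟩ => by rw [h, h']; exact hab, hcut y x hy hx⟩
    · rw [glue_adj_notMem_notMem hx hy]; rfl

end Cutting

/-! ### Sums over labelled trees and the edge-cutting identity. -/

section TreeSum

variable {n : ℕ} {K : Type*} [CommRing K]

/-- The sum of the terms of all trees with vertex set `V`. -/
noncomputable def treeSum (V : Type*) [Fintype V] (P : MvPowerSeries (Fin n) K) :
    MvPowerSeries (Fin n) K :=
  ∑ T : LabelledTree V, graphTerm T.1 P

/-- A relabelling of the vertices induces a bijection of the sets of trees. -/
def labelledTreeCongr {V W : Type*} (e : V ≃ W) : LabelledTree V ≃ LabelledTree W where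
  toFun T := ⟨T.1.comap e.symm, (SimpleGraph.Iso.comap e.symm T.1).isTree_iff.2 T.2⟩
  invFun T := ⟨T.1.comap e, (SimpleGraph.Iso.comap e T.1).isTree_iff.2 T.2⟩
  left_inv T := by ext; simp
  right_inv T := by ext; simp

theorem treeSum_congr {V W : Type*} [Fintype V] [Fintype W] (e : V ≃ W)
    (P : MvPowerSeries (Fin n) K) : treeSum V P = treeSum W P :=
  Fintype.sum_equiv (labelledTreeCongr e) _ _ fun T =>
    graphTerm_iso (SimpleGraph.Iso.comap e.symm T.1).symm P

theorem pderiv_treeSum (V : Type*) [Fintype V] (i : Fin n) (P : MvPowerSeries (Fin n) K) :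
    pderiv K i (treeSum V P) = ∑ q : LabelledTree V × V, markedTerm q.1.1 q.2 i P := by
  rw [treeSum, map_sum, Fintype.sum_prod_type]
  exact Finset.sum_congr rfl fun T _ => pderiv_graphTerm _ _ _

/-- A tree with an oriented edge, as a dart of a tree. -/
def dartTreeEquiv (V : Type*) : (Σ T : LabelledTree V, T.1.Dart) ≃ DartTree V where
  toFun q := ⟨(q.1.1, q.2.fst, q.2.snd), q.1.2, q.2.adj⟩
  invFun q := ⟨⟨q.1.1, q.2.1⟩, ⟨(q.1.2.1, q.1.2.2), q.2.2⟩⟩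
  left_inv _ := rfl
  right_inv _ := rfl

theorem card_dart_of_isTree {V : Type*} [Fintype V] {T : SimpleGraph V} (hT : T.IsTree)
    [Fintype T.Dart] : Fintype.card T.Dart = 2 * (Fintype.card V - 1) := by
  classical
  have h1 := T.dart_card_eq_twice_card_edges
  have h2 := hT.card_edgeFinset
  rw [← h2, Nat.add_sub_cancel, ← h1]
  congr!

theorem sum_graphTerm_joinGraph (A B : Type*) [Fintype A] [Fintype B]
    (P : MvPowerSeries (Fin n) K) :
    ∑ q : (LabelledTree A × LabelledTree B) × (A × B),
      graphTerm (joinGraph q.1.1.1 q.1.2.1 q.2.1 q.2.2) P =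
      ∑ i, pderiv K i (treeSum A P) * pderiv K i (treeSum B P) := by
  simp only [graphTerm_joinGraph]
  rw [Finset.sum_comm]
  refine Finset.sum_congr rfl fun i _ => ?_
  rw [pderiv_treeSum, pderiv_treeSum, Finset.sum_mul_sum, ← Fintype.sum_prod_type']
  exact Fintype.sum_equiv (Equiv.prodProdProdComm _ _ _ _) _ _ fun q => rfl

/-- Cutting a tree at each of its edges. -/
theorem card_smul_treeSum (V : Type*) [Fintype V] [DecidableEq V] (P : MvPowerSeries (Fin n) K) :
    (2 * (Fintype.card V - 1)) • treeSum V P = ∑ S : Finset V, ∑ i,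
      pderiv K i (treeSum {x // x ∈ S} P) * pderiv K i (treeSum {x // x ∉ S} P) := by
  have : Fintype (DartTree V) := Fintype.ofFinite _
  have : ∀ T : LabelledTree V, Fintype T.1.Dart := by
    classical exact fun T => inferInstance
  -- Each tree is counted once for each of its 2(|V| - 1) oriented edges.
  have h1 : (2 * (Fintype.card V - 1)) • treeSum V P = ∑ q : DartTree V, graphTerm q.1.1 P := by
    rw [← (dartTreeEquiv V).sum_comp, Fintype.sum_sigma, treeSum, Finset.smul_sum]
    refine Finset.sum_congr rfl fun T _ => ?_
    rw [← card_dart_of_isTree T.2, ← Finset.card_univ, ← Finset.sum_const]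
    rfl
  rw [h1, ← SplitTree.glue_bijective.sum_comp, Fintype.sum_sigma]
  refine Finset.sum_congr rfl fun S _ => ?_
  rw [← sum_graphTerm_joinGraph]
  exact Finset.sum_congr rfl fun q _ => graphTerm_iso (glueIso _ _ _ _) P

end TreeSum

/-! ### Lower bounds for the order of tree terms. -/

section Vanishing

variable {n : ℕ} {K : Type*} [CommRing K] {P : MvPowerSeries (Fin n) K}

/-- Each derivative after the first costs one order. The case s = 0 is excluded because the constant
term of `P` is arbitrary. -/
theorem le_order_iterPderiv (hP : ∀ i, 2 ≤ (pderiv K i P).order) {s : Multiset (Fin n)}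
    (hs : s ≠ 0) {k : ℕ} (hk : k + s.card ≤ 3) : (k : ℕ∞) ≤ (iterPderiv s P).order := by
  induction s using Multiset.induction_on generalizing k with
  | empty => exact absurd rfl hs
  | cons i s ih =>
    rw [← Multiset.singleton_add, iterPderiv_singleton_add]
    rw [Multiset.card_cons] at hk
    by_cases h : s = 0
    · subst h
      rw [Multiset.card_zero] at hk
      exact le_trans (by exact_mod_cast (by omega : k ≤ 2)) (hP i)
    · exact le_order_pderiv i (ih h (by omega))

theorem card_adjLabels {V : Type*} [Fintype V] (T : SimpleGraph V) (l : T.edgeSet → Fin n) (v : V)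
    [Fintype T.edgeSet] [DecidableEq V] :
    (adjLabels T l v).card = ∑ e : T.edgeSet, if v ∈ (e : Sym2 V) then 1 else 0 := by
  classical
  rw [adjLabels_eq_sum T (Equiv.refl _), Multiset.card_sum]
  refine Finset.sum_congr rfl fun e _ => ?_
  rw [Equiv.refl_apply]
  by_cases h : v ∈ (e : Sym2 V)
  · rw [if_pos h, if_pos h, Multiset.card_singleton]
  · rw [if_neg h, if_neg h, Multiset.card_zero]

theorem adjLabels_ne_zero {V : Type*} [Fintype V] [Nontrivial V] {T : SimpleGraph V}
    (hT : T.Connected) (l : T.edgeSet → Fin n) (v : V) : adjLabels T l v ≠ 0 := by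
  classical
  obtain ⟨w, hw⟩ := (T.degree_pos_iff_exists_adj v).1
    (hT.preconnected.degree_pos_of_nontrivial v)
  rw [← Multiset.card_pos, card_adjLabels]
  refine Finset.sum_pos' (fun _ _ => Nat.zero_le _) ⟨⟨s(v, w), hw⟩, Finset.mem_univ _, ?_⟩
  simp

theorem sum_card_adjLabels {V : Type*} [Fintype V] {T : SimpleGraph V} (hT : T.IsTree)
    (l : T.edgeSet → Fin n) : ∑ v, (adjLabels T l v).card = 2 * (Fintype.card V - 1) := by
  classical
  have h : ∀ e : T.edgeSet, (∑ v : V, if v ∈ (e : Sym2 V) then 1 else 0) = 2 := by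
    rintro ⟨e, he⟩
    rw [← Finset.card_filter, ← Sym2.card_toFinset_of_not_isDiag e (T.not_isDiag_of_mem_edgeSet he)]
    congr 1
    ext v
    simp
  simp only [card_adjLabels]
  rw [Finset.sum_comm, Finset.sum_congr rfl fun e _ => h e, Finset.sum_const, Finset.card_univ,
    ← hT.card_edgeFinset, Nat.add_sub_cancel, SimpleGraph.edgeFinset_card, smul_eq_mul, mul_comm]

/-- Sum 3 - deg v over the vertices, with degree sum 2(|V| - 1); vertices of degree above 3
contribute zero, which only helps. A one-vertex tree is excluded, since its term is `P` itself. -/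
theorem le_order_graphTerm (hP : ∀ i, 2 ≤ (pderiv K i P).order) {V : Type*} [Fintype V]
    [Nontrivial V] {T : SimpleGraph V} (hT : T.IsTree) :
    ((Fintype.card V + 2 : ℕ) : ℕ∞) ≤ (graphTerm T P).order := by
  refine le_order_sum _ fun l _ => le_trans ?_ (le_order_prod _ _)
  have h1 : ∀ v ∈ Finset.univ, ((3 - (adjLabels T l v).card : ℕ) : ℕ∞) ≤
      (iterPderiv (adjLabels T l v) P).order ∨ 3 < (adjLabels T l v).card := fun v _ => by
    rcases le_or_gt (adjLabels T l v).card 3 with h | h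
    · exact .inl (le_order_iterPderiv hP (adjLabels_ne_zero hT.connected l v) (by omega))
    · exact .inr h
  have h2 : ((∑ v, (3 - (adjLabels T l v).card) : ℕ) : ℕ∞) ≤
      ∑ v, (iterPderiv (adjLabels T l v) P).order := by
    rw [Nat.cast_sum]
    refine Finset.sum_le_sum fun v hv => (h1 v hv).elim id fun h => ?_
    rw [Nat.sub_eq_zero_of_le h.le]
    exact zero_le
  refine le_trans ?_ h2
  have h3 : ∑ _v : V, 3 ≤ ∑ v, (3 - (adjLabels T l v).card) + ∑ v, (adjLabels T l v).card := by
    rw [← Finset.sum_add_distrib]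
    exact Finset.sum_le_sum fun v _ => by omega
  rw [sum_card_adjLabels hT, Finset.sum_const, Finset.card_univ, smul_eq_mul] at h3
  have h4 : 0 < Fintype.card V := Fintype.card_pos
  exact_mod_cast (by omega)

end Vanishing

/-! ### Exponential weights and the recursion by number of vertices. -/

section Weighted

variable {n : ℕ} {K : Type*} [CommRing K] (P : MvPowerSeries (Fin n) K)

theorem treeSum_of_isEmpty (V : Type*) [Fintype V] [IsEmpty V] : treeSum V P = 0 := by
  have : IsEmpty (LabelledTree V) := ⟨fun T => isEmptyElim T.2.connected.nonempty.some⟩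
  rw [treeSum, Fintype.sum_empty]

theorem treeSum_of_unique (V : Type*) [Fintype V] [Unique V] : treeSum V P = P := by
  classical
  have : Unique (LabelledTree V) :=
    { default := ⟨⊥, SimpleGraph.IsTree.of_subsingleton⟩
      uniq := fun T => Subtype.ext (Subsingleton.elim _ _) }
  have hE : IsEmpty (default : LabelledTree V).1.edgeSet := by
    rw [show (default : LabelledTree V).1 = ⊥ from Subsingleton.elim _ _]
    simp
  rw [treeSum, Fintype.sum_unique, graphTerm,
    Finset.sum_eq_single default (fun l _ hl => absurd (Subsingleton.elim _ _) hl)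
      (fun h => absurd (@Finset.mem_univ _ (_) _) h), Fintype.prod_unique]
  have h : adjLabels (default : LabelledTree V).1 default (default : V) = (0 : Multiset (Fin n)) := by
    rw [adjLabels_eq_sum _ (Equiv.refl _), Fintype.sum_empty]
  rw [h, iterPderiv, Multiset.foldr_zero]

variable [Algebra ℚ K]

/-- The weighted sum of the terms of the trees with `m` vertices. -/
noncomputable def weightedTreeSum (m : ℕ) : MvPowerSeries (Fin n) K :=
  ((m.factorial : ℚ)⁻¹) • treeSum (Fin m) P

theorem weightedTreeSum_zero : weightedTreeSum P 0 = 0 := by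
  rw [weightedTreeSum, treeSum_of_isEmpty, smul_zero]

theorem weightedTreeSum_one : weightedTreeSum P 1 = P := by
  rw [weightedTreeSum, treeSum_of_unique]
  simp

theorem pderiv_qsmul (i : Fin n) (c : ℚ) (f : MvPowerSeries (Fin n) K) :
    pderiv K i (c • f) = c • pderiv K i f :=
  map_rat_smul (pderiv K i : MvPowerSeries (Fin n) K →ₗ[K] MvPowerSeries (Fin n) K) c f

theorem coeff_qsmul (d : Fin n →₀ ℕ) (c : ℚ) (f : MvPowerSeries (Fin n) K) :
    coeff d (c • f) = c • coeff d f :=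
  map_rat_smul (coeff d : MvPowerSeries (Fin n) K →ₗ[K] K) c f

/-- The summand for a subset S depends only on k = |S|, and binom(m, k) / m! = 1 / (k! (m-k)!) turns
the sum over subsets into a convolution. -/
theorem smul_weightedTreeSum (m : ℕ) :
    (2 * (m - 1)) • weightedTreeSum P m = ∑ x ∈ Finset.HasAntidiagonal.antidiagonal m, ∑ i,
      pderiv K i (weightedTreeSum P x.1) * pderiv K i (weightedTreeSum P x.2) := by
  have h := card_smul_treeSum (Fin m) P
  rw [Fintype.card_fin] at h
  have hS : ∀ S : Finset (Fin m), ∑ i,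
      pderiv K i (treeSum {x // x ∈ S} P) * pderiv K i (treeSum {x // x ∉ S} P) =
      (fun k => ∑ i, pderiv K i (treeSum (Fin k) P) * pderiv K i (treeSum (Fin (m - k)) P))
        S.card := fun S => by
    have hc : Fintype.card {x // x ∉ S} = m - S.card := by
      rw [Fintype.card_subtype_compl, Fintype.card_fin, Fintype.card_coe]
    rw [treeSum_congr (Fintype.equivFinOfCardEq (Fintype.card_coe S)) P,
      treeSum_congr (Fintype.equivFinOfCardEq hc) P]
  rw [weightedTreeSum, smul_comm, h, Finset.sum_congr rfl fun S _ => hS S,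
    ← Finset.powerset_univ, Finset.sum_powerset_apply_card (fun k => ∑ i,
      pderiv K i (treeSum (Fin k) P) * pderiv K i (treeSum (Fin (m - k)) P)), Finset.card_univ,
    Fintype.card_fin, Finset.Nat.sum_antidiagonal_eq_sum_range_succ_mk, Finset.smul_sum]
  refine Finset.sum_congr rfl fun k hk => ?_
  have hk : k ≤ m := Nat.lt_succ_iff.1 (Finset.mem_range.1 hk)
  rw [← Nat.cast_smul_eq_nsmul ℚ, smul_smul, Finset.smul_sum]
  refine Finset.sum_congr rfl fun i _ => ?_
  rw [weightedTreeSum, weightedTreeSum, pderiv_qsmul, pderiv_qsmul, smul_mul_smul_comm]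
  congr 1
  rw [Nat.cast_choose ℚ hk]
  have := Nat.factorial_ne_zero m
  field_simp

/-- Splittings with an empty side vanish, since a tree has a vertex. After the shift, j + 1 and the
indices in `x` count edges. -/
theorem smul_weightedTreeSum_add_two (j : ℕ) :
    (2 * (j + 1)) • weightedTreeSum P (j + 2) =
      ∑ i, ∑ x ∈ Finset.HasAntidiagonal.antidiagonal j,
        pderiv K i (weightedTreeSum P (x.1 + 1)) * pderiv K i (weightedTreeSum P (x.2 + 1)) := by
  have h := smul_weightedTreeSum P (j + 2)
  rw [Finset.Nat.sum_antidiagonal_succ, Finset.Nat.sum_antidiagonal_succ'] at h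
  simp only [weightedTreeSum_zero, map_zero, zero_mul, mul_zero, Finset.sum_const_zero,
    zero_add] at h
  rw [Finset.sum_comm, ← h]
  rfl

theorem le_order_weightedTreeSum {P : MvPowerSeries (Fin n) K}
    (hP : ∀ i, 2 ≤ (pderiv K i P).order) (j : ℕ) :
    ((j + 4 : ℕ) : ℕ∞) ≤ (weightedTreeSum P (j + 2)).order := by
  have h : ((j + 4 : ℕ) : ℕ∞) ≤ (treeSum (Fin (j + 2)) P).order :=
    le_order_sum _ fun T _ => by
      have := le_order_graphTerm hP T.2
      rwa [Fintype.card_fin] at this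
  refine h.trans (le_order fun d hd => ?_)
  rw [weightedTreeSum, coeff_qsmul, coeff_of_lt_order hd, smul_zero]

end Weighted

/-! ### Isomorphism classes, automorphisms and formal convergence. -/

section FreeTrees

/-- The isomorphism class of a tree on `{0, …, m - 1}`. -/
def LabelledTree.toFree {m : ℕ} (T : LabelledTree (Fin m)) : FreeTree :=
  Quotient.mk finTreeSetoid ⟨m, T⟩

theorem LabelledTree.toFree_eq_iff {m : ℕ} {S T : LabelledTree (Fin m)} :
    S.toFree = T.toFree ↔ Nonempty (S.1 ≃g T.1) :=
  Quotient.eq (r := finTreeSetoid)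

/-- The number of vertices of a free tree. -/
def FreeTree.size (T : FreeTree) : ℕ :=
  Quotient.lift (fun S : FinTree => S.1)
    (by rintro S S' ⟨φ⟩; simpa using Fintype.card_congr φ.toEquiv) T

theorem FreeTree.exists_toFree_eq (T : FreeTree) :
    ∃ S : LabelledTree (Fin T.size), S.toFree = T := by
  induction T using Quotient.inductionOn with
  | h S => exact ⟨S.2, rfl⟩

/-- The relabellings that carry one tree to another are the isomorphisms between them. -/
def relabelEquivIso {m : ℕ} (S T : LabelledTree (Fin m)) :
    {σ : Equiv.Perm (Fin m) // labelledTreeCongr σ S = T} ≃ (S.1 ≃g T.1) where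
  toFun σ := ⟨σ.1, fun {x y} => by
    obtain ⟨σ, rfl⟩ := σ
    simp [labelledTreeCongr]⟩
  invFun φ := ⟨φ.toEquiv, Subtype.ext (by
    ext x y
    exact φ.symm.map_adj_iff)⟩
  left_inv _ := rfl
  right_inv _ := rfl

/-- The orbit-stabilizer theorem for the labellings of a free tree. -/
theorem card_labellings_mul_cardAut {m : ℕ} (S : LabelledTree (Fin m))
    [DecidablePred fun T : LabelledTree (Fin m) => T.toFree = S.toFree] :
    (Finset.univ.filter fun T : LabelledTree (Fin m) => T.toFree = S.toFree).card *
      S.toFree.cardAut = m.factorial := by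
  classical
  -- Sort the m! permutations by the relabelled tree they produce; each fibre is a set of
  -- isomorphisms S ≅ T, in bijection with Aut S.
  have h := Finset.card_eq_sum_card_fiberwise (s := (Finset.univ : Finset (Equiv.Perm (Fin m))))
    (t := Finset.univ.filter fun T : LabelledTree (Fin m) => T.toFree = S.toFree)
    (f := fun σ => labelledTreeCongr σ S) (fun σ _ => by
      rw [Finset.mem_coe, Finset.mem_filter]
      exact ⟨Finset.mem_univ _, LabelledTree.toFree_eq_iff.2
        ⟨SimpleGraph.Iso.comap σ.symm S.1⟩⟩)
  rw [Finset.card_univ, Fintype.card_perm, Fintype.card_fin] at h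
  rw [h, ← smul_eq_mul, ← Finset.sum_const]
  refine Finset.sum_congr rfl fun T hT => ?_
  obtain ⟨φ⟩ := LabelledTree.toFree_eq_iff.1 (Finset.mem_filter.1 hT).2
  rw [← Fintype.card_subtype, ← Nat.card_eq_fintype_card, Nat.card_congr (relabelEquivIso S T)]
  exact Nat.card_congr
    { toFun := fun a => a.trans φ.symm
      invFun := fun b => b.trans φ
      left_inv := fun a => by ext; simp
      right_inv := fun b => by ext; simp }

open Classical in
/-- The free trees with `m` vertices. -/
noncomputable def freeTreesOfSize (m : ℕ) : Finset FreeTree :=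
  Finset.univ.image (LabelledTree.toFree (m := m))

theorem mem_freeTreesOfSize {m : ℕ} {T : FreeTree} : T ∈ freeTreesOfSize m ↔ T.size = m := by
  classical
  rw [freeTreesOfSize, Finset.mem_image]
  constructor
  · rintro ⟨S, -, rfl⟩
    rfl
  · rintro rfl
    obtain ⟨S, hS⟩ := T.exists_toFree_eq
    exact ⟨S, Finset.mem_univ _, hS⟩

/-- A sum over free trees weighted by automorphisms, as a sum over labelled trees. -/
theorem sum_freeTreesOfSize {M : Type*} [AddCommGroup M] [Module ℚ M] (m : ℕ) (h : FreeTree → M) :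
    ∑ T ∈ freeTreesOfSize m, (1 / (T.cardAut : ℚ)) • h T =
      ((m.factorial : ℚ)⁻¹) • ∑ S : LabelledTree (Fin m), h S.toFree := by
  classical
  rw [Finset.sum_comp h LabelledTree.toFree, Finset.smul_sum, ← freeTreesOfSize]
  refine Finset.sum_congr rfl fun T hT => ?_
  obtain rfl := mem_freeTreesOfSize.1 hT
  obtain ⟨S, hS⟩ := T.exists_toFree_eq
  have h1 := card_labellings_mul_cardAut S
  rw [hS] at h1
  have h2 : T.cardAut ≠ 0 := fun h0 => Nat.factorial_ne_zero T.size (by rw [← h1, h0, mul_zero])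
  rw [← Nat.cast_smul_eq_nsmul ℚ, smul_smul]
  congr 1
  rw [← h1, Nat.cast_mul]
  have h3 : ((Finset.univ.filter fun S : LabelledTree (Fin T.size) => S.toFree = T).card : ℚ) ≠ 0 :=
    Nat.cast_ne_zero.2 fun h0 => Nat.factorial_ne_zero T.size (by rw [← h1, h0, zero_mul])
  field_simp

theorem FreeTree.size_pos (T : FreeTree) : 0 < T.size := by
  obtain ⟨S, -⟩ := T.exists_toFree_eq
  exact Fin.pos_iff_nonempty.2 S.2.connected.nonempty

variable {n : ℕ} {K : Type*} [CommRing K]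

theorem le_order_term {P : MvPowerSeries (Fin n) K} (hP : ∀ i, 2 ≤ (pderiv K i P).order)
    {T : FreeTree} (hT : 2 ≤ T.size) : ((T.size + 2 : ℕ) : ℕ∞) ≤ (T.term P).order := by
  obtain ⟨S, hS⟩ := T.exists_toFree_eq
  have : Nontrivial (Fin T.size) := Fin.nontrivial_iff_two_le.2 hT
  have h := le_order_graphTerm hP S.2
  rw [Fintype.card_fin] at h
  have h2 : T.term P = graphTerm S.1 P := (congrArg (fun T => T.term P) hS).symm
  rwa [h2]

theorem isFormalSum_weightedTreeSum [Algebra ℚ K] {P : MvPowerSeries (Fin n) K}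
    (hP : ∀ i, 2 ≤ (pderiv K i P).order) {Q : MvPowerSeries (Fin n) K}
    (hQ : ∀ d, coeff d Q =
      ∑ j ∈ Finset.range (d.degree + 1), coeff d (weightedTreeSum P (j + 1))) :
    IsFormalSum (fun T : FreeTree => (1 / (T.cardAut : ℚ)) • T.term P) Q := by
  classical
  intro d
  -- Trees with 1 to |d| + 1 vertices: any larger tree has at least two vertices and a term of order
  -- above |d|. The one-vertex tree is kept even for d = 0.
  set s := (Finset.range (d.degree + 1)).biUnion fun j => freeTreesOfSize (j + 1) with hs
  have hsub : {T : FreeTree | coeff d ((1 / (T.cardAut : ℚ)) • T.term P) ≠ 0} ⊆ s := by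
    intro T hT
    rw [hs, Finset.mem_coe, Finset.mem_biUnion]
    have hpos := T.size_pos
    refine ⟨T.size - 1, Finset.mem_range.2 ?_, mem_freeTreesOfSize.2 (by omega)⟩
    by_contra hlt
    refine hT ?_
    rw [coeff_qsmul, coeff_of_lt_order, smul_zero]
    refine lt_of_lt_of_le ?_ (le_order_term hP (by omega))
    exact_mod_cast (by omega : d.degree < T.size + 2)
  refine ⟨s.finite_toSet.subset hsub, ?_⟩
  rw [finsum_eq_sum_of_support_subset _ hsub, hs, Finset.sum_biUnion, hQ]
  · refine Finset.sum_congr rfl fun j _ => ?_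
    rw [← map_sum, sum_freeTreesOfSize]
    rfl
  · intro i _ j _ hij
    refine Finset.disjoint_left.2 fun T hi hj => hij ?_
    rw [mem_freeTreesOfSize] at hi hj
    omega

end FreeTrees

/-! ### Formal inverses of maps of special type, and the conclusion. -/

theorem isSpecialType_iff {n : ℕ} {K : Type*} [CommRing K] {F : Fin n → MvPowerSeries (Fin n) K} :
    IsSpecialType F ↔ ∀ i, 2 ≤ (F i - X i).order :=
  forall_congr' fun _ => ⟨fun h => nat_le_order (n := 2) fun d hd => h d (Nat.lt_succ_iff.1 hd),
    fun h d hd => coeff_of_lt_order (lt_of_lt_of_le (by exact_mod_cast Nat.lt_succ_iff.2 hd) h)⟩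

theorem IsSpecialType.one_le_order {n : ℕ} {K : Type*} [CommRing K]
    {F : Fin n → MvPowerSeries (Fin n) K} (hF : IsSpecialType F) (i : Fin n) :
    1 ≤ (F i).order := by
  rw [← sub_add_cancel (F i) (X i)]
  exact (le_min (le_trans (by norm_num) (isSpecialType_iff.1 hF i)) (one_le_order_X i)).trans
    min_order_le_add

/-- A right inverse of special type of a map of special type is its only formal inverse. -/
theorem isFormalInverse_iff_eq {n : ℕ} {K : Type*} [CommRing K] [Algebra ℚ K]
    {F G : Fin n → MvPowerSeries (Fin n) K} (hF : IsSpecialType F) (hG : IsSpecialType G)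
    (h : ∀ i, comp F G i = X i) (G' : Fin n → MvPowerSeries (Fin n) K) :
    IsFormalInverse F G' ↔ G' = G := by
  have hF2 : ∀ i, 2 ≤ (X i - F i).order := fun i => by
    rw [← neg_sub, order_neg]
    exact isSpecialType_iff.1 hF i
  constructor
  · rintro ⟨hs, hr, -⟩
    exact eq_of_subst_eq hF2 hs.one_le_order hG.one_le_order fun i => (hr i).trans (h i).symm
  · rintro rfl
    refine ⟨hG, h, fun i => ?_⟩
    have hsF := hasSubst_of_one_le_order hF.one_le_order
    have hsG := hasSubst_of_one_le_order hG.one_le_order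
    -- F ∘ (G ∘ F) = (F ∘ G) ∘ F = F = F ∘ X; cancel F on the left.
    refine congrFun (eq_of_subst_eq (A := fun i => subst F (G' i)) hF2 (fun i =>
      (hG.one_le_order i).trans (le_order_subst_of_one_le hsF hF.one_le_order _))
      one_le_order_X fun j => ?_) i
    rw [← subst_comp_subst_apply hsG hsF, show subst G' (F j) = X j from h j, subst_X hsF,
      subst_self, id]

end SymTree

theorem theorem2p3 {n : ℕ} {K : Type*} [CommRing K] [Algebra ℚ K]
    (F : Fin n → MvPowerSeries (Fin n) K) (P : MvPowerSeries (Fin n) K)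
    (hF : SymTree.IsSpecialType F)
    (hP : ∀ i, F i = MvPowerSeries.X i - MvPowerSeries.pderiv K i P) :
    ∃ Q : MvPowerSeries (Fin n) K,
      SymTree.IsFormalSum
        (fun T : SymTree.FreeTree => (1 / (T.cardAut : ℚ)) • T.term P) Q ∧
      ∀ G : Fin n → MvPowerSeries (Fin n) K,
        SymTree.IsFormalInverse F G ↔
          ∀ i, G i = MvPowerSeries.X i + MvPowerSeries.pderiv K i Q := by
  have hord : ∀ i, 2 ≤ (MvPowerSeries.pderiv K i P).order := fun i => by
    have h := SymTree.isSpecialType_iff.1 hF i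
    rwa [hP, sub_sub_cancel_left, MvPowerSeries.order_neg] at h
  obtain ⟨Q, hQ⟩ : ∃ Q : MvPowerSeries (Fin n) K, ∀ d, MvPowerSeries.coeff d Q =
      ∑ j ∈ Finset.range (d.degree + 1),
        MvPowerSeries.coeff d (SymTree.weightedTreeSum P (j + 1)) :=
    ⟨fun d => ∑ j ∈ Finset.range (d.degree + 1),
      MvPowerSeries.coeff d (SymTree.weightedTreeSum P (j + 1)), fun _ => rfl⟩
  refine ⟨Q, SymTree.isFormalSum_weightedTreeSum hord hQ, fun G => ?_⟩
  obtain ⟨h1, h2⟩ := SymTree.pderiv_eq_subst_of_recursion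
    (q := fun j => SymTree.weightedTreeSum P (j + 1))
    (by simpa only [zero_add, SymTree.weightedTreeSum_one] using hord)
    (SymTree.le_order_weightedTreeSum hord) (SymTree.smul_weightedTreeSum_add_two P) hQ
  simp only [zero_add, SymTree.weightedTreeSum_one] at h2
  have hG : SymTree.IsSpecialType fun i => MvPowerSeries.X i + MvPowerSeries.pderiv K i Q :=
    SymTree.isSpecialType_iff.2 fun i => by rw [add_sub_cancel_left]; exact h1 i
  rw [SymTree.isFormalInverse_iff_eq hF hG fun i => ?_, funext_iff]
  have hs := SymTree.hasSubst_of_one_le_order hG.one_le_order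
  -- With G = X + ∇Q, F ∘ G = G - ∇P(G) = X + ∇Q - ∇Q by the fixed-point equation `h2`.
  rw [SymTree.comp, hP, MvPowerSeries.subst_sub hs, MvPowerSeries.subst_X hs, ← h2,
    add_sub_cancel_right]
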